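/- Let $(\Omega,\mu)$ be a $\sigma$-finite measure space with $\mu$ non-atomic, and let $\mathcal M(\Omega,\mu)$ be the space of (classes modulo $\mu$-a.e. equality of) $\mu$-measurable scalar-valued (real or complex) functions on $\Omega$. For $f\in\mathcal M(\Omega,\mu)$ let $f^*(t)=\inf\{\lambda\ge 0:\mu(\{|f|>\lambda\})\le t\}$, $t>0$ (with $\inf\emptyset=\infty$), be its non-increasing rearrangement. Write $\|\cdot\|_{q,(\alpha,\beta)}$ for the (quasi-)norm of the Lebesgue space $L_q$ on the interval $(\alpha,\beta)$, $0<q\le\infty$, and put $1/\infty=0$, $1/0=\infty$. A positive Lebesgue measurable function $b$ on $(0,\infty)$ is called slowly varying, $b\in SV$, if for each $\varepsilon>0$ the function $t\mapsto t^{\varepsilon}b(t)$ is equivalent to a non-decreasing function and $t\mapsto t^{-\varepsilon}b(t)$ is equivalent to a non-increasing function on $(0,\infty)$, where $g\approx h$ means $C^{-1}g\le h\le Cg$ on $(0,\infty)$ for some constant $C>0$. For $0<p,q\le\infty$ let $L_p$ be the Lebesgue space on $(\Omega,\mu)$ and let $L_{p,q}$ be the Lorentz space with quasi-norm $\|f\|_{p,q}=\|t^{\frac1p-\frac1q}f^*(t)\|_{q,(0,\infty)}$.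 For a couple $(A_0,A_1)$ of quasi-normed subspaces of $\mathcal M(\Omega,\mu)$ and $t>0$, let $$K(t,f;A_0,A_1)=\inf\{\|f_0\|_{A_0}+t\|f_1\|_{A_1}: f=f_0+f_1,\ f_i\in A_i,\ i=0,1\}.$$ For $0\le\theta\le1$, $0<s,r,q\le\infty$ and $a,b,c\in SV$, the extremal interpolation space $(A_0,A_1)^{\mathcal L,\mathcal L}_{\theta,s,c,r,b,q,a}$ is the set of all $f\in A_0+A_1$ for which the quasi-norm $$\bigg\|t^{-\frac1s}c(t)\Big\|u^{-\frac1r}b(u)\big\|v^{-\theta-\frac1q}a(v)K(v,f;A_0,A_1)\big\|_{q,(0,u)}\Big\|_{r,(0,t)}\bigg\|_{s,(0,\infty)}$$ is finite. For $0<p\le\infty$, the $\mathcal L\mathcal L$ Lorentz–Karamata space $L^{\mathcal L,\mathcal L}_{p,(s,c,r,b,q,a)}$ is the set of all $f\in\mathcal M(\Omega,\mu)$ for which the quasi-norm $$\bigg\|t^{-\frac1s}c(t)\Big\|u^{-\frac1r}b(u)\big\|v^{\frac1p-\frac1q}a(v)f^*(v)\big\|_{q,(0,u)}\Big\|_{r,(0,t)}\bigg\|_{s,(0,\infty)}$$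 is finite. Two quasi-normed spaces are called equal if they have the same elements and their quasi-norms are equivalent. **Theorem.** Let $0<\theta\le1$, $0<\varkappa<\infty$, $p=\frac{\varkappa}{1-\theta}$ (so $p=\infty$ if $\theta=1$), $0<q,r,s\le\infty$ and $a,b,c\in SV$. Put $\tilde a(t)=a(t^{1/\varkappa})$, $\tilde b(t)=b(t^{1/\varkappa})$, $\tilde c(t)=c(t^{1/\varkappa})$ for $t>0$. Then $$(L_\varkappa,L_\infty)^{\mathcal L,\mathcal L}_{\theta,s,c,r,b,q,a}=(L_{\varkappa,\infty},L_\infty)^{\mathcal L,\mathcal L}_{\theta,s,c,r,b,q,a}=L^{\mathcal L,\mathcal L}_{p,(s,\tilde c,r,\tilde b,q,\tilde a)},$$ with equality of sets and equivalence of quasi-norms. -/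

import Mathlib

open MeasureTheory Set
open scoped ENNReal NNReal

noncomputable section

namespace LorentzKaramata

/-- Slowly varying functions on `(0,∞)`: positive, Lebesgue measurable, and for every `ε > 0`,
`t ^ ε * b t` is equivalent to a non-decreasing function and `t ^ (-ε) * b t` is equivalent to a
non-increasing function on `(0,∞)`. Values of `b` outside `(0,∞)` are irrelevant. -/
structure SlowlyVarying (b : ℝ → ℝ) : Prop where
  pos : ∀ t, 0 < t → 0 < b t
  measurable : AEMeasurable b (volume.restrict (Ioi 0))
  equiv_mono : ∀ ε : ℝ, 0 < ε → ∃ (g : ℝ → ℝ) (C : ℝ), MonotoneOn g (Ioi 0) ∧ 0 < C ∧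
    ∀ t, 0 < t → t ^ ε * b t ≤ C * g t ∧ g t ≤ C * (t ^ ε * b t)
  equiv_anti : ∀ ε : ℝ, 0 < ε → ∃ (g : ℝ → ℝ) (C : ℝ), AntitoneOn g (Ioi 0) ∧ 0 < C ∧
    ∀ t, 0 < t → t ^ (-ε) * b t ≤ C * g t ∧ g t ≤ C * (t ^ (-ε) * b t)

/-- The measure `μ` has no atoms in the measure-theoretic sense: every measurable set of positive
measure has a measurable subset of strictly smaller positive measure. -/
def NonAtomic {Ω : Type*} [MeasurableSpace Ω] (μ : Measure Ω) : Prop :=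
  ∀ A : Set Ω, MeasurableSet A → 0 < μ A → ∃ B ⊆ A, MeasurableSet B ∧ 0 < μ B ∧ μ B < μ A

/-- A (quasi-)normed space sitting inside an ambient vector space `V`, recorded by its set of
elements and its quasi-norm. The quasi-norm takes values in `[0,∞]`; only its values on `carrier`
matter. -/
structure QSpace (V : Type*) where
  carrier : Set V
  qnorm : V → ℝ≥0∞

/-- Continuous embedding `X ⊂ Y`. -/
def QSpace.Embeds {V : Type*} (X Y : QSpace V) : Prop :=
  X.carrier ⊆ Y.carrier ∧ ∃ C : ℝ≥0, ∀ f ∈ X.carrier, Y.qnorm f ≤ C * X.qnorm f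

/-- Equality of quasi-normed spaces: the same elements and equivalent quasi-norms. -/
def QSpace.Identical {V : Type*} (X Y : QSpace V) : Prop :=
  X.Embeds Y ∧ Y.Embeds X

/-- The weighted quasi-norm `‖ t ^ (α - 1/q) w(t) F(t) ‖_{q, I}`, with `1/∞ = 0`. -/
def wnorm (q : ℝ≥0∞) (α : ℝ) (w : ℝ → ℝ) (F : ℝ → ℝ≥0∞) (I : Set ℝ) : ℝ≥0∞ :=
  eLpNorm (fun t : ℝ => ENNReal.ofReal (t ^ (α - (q⁻¹).toReal) * w t) * F t) q
    (volume.restrict I)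

/-- The iterated quasi-norm
`‖ t^(-1/s) c(t) ‖ u^(-1/r) b(u) ‖ v^(α-1/q) a(v) F(v) ‖_{q,(0,u)} ‖_{r,(0,t)} ‖_{s,(0,∞)}`. -/
def llNorm (α : ℝ) (s : ℝ≥0∞) (c : ℝ → ℝ) (r : ℝ≥0∞) (b : ℝ → ℝ) (q : ℝ≥0∞) (a : ℝ → ℝ)
    (F : ℝ → ℝ≥0∞) : ℝ≥0∞ :=
  wnorm s 0 c (fun t => wnorm r 0 b (fun u => wnorm q α a F (Ioo 0 u)) (Ioo 0 t)) (Ioi 0)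

/-- The sum `A₀ + A₁` of two spaces inside the same ambient space. -/
def sumSet {V : Type*} [Add V] (A₀ A₁ : QSpace V) : Set V :=
  {f | ∃ f₀ ∈ A₀.carrier, ∃ f₁ ∈ A₁.carrier, f = f₀ + f₁}

/-- Peetre's `K`-functional `K(t, f; A₀, A₁)`. -/
def kFunctional {V : Type*} [Add V] (A₀ A₁ : QSpace V) (t : ℝ) (f : V) : ℝ≥0∞ :=
  ⨅ (f₀ ∈ A₀.carrier) (f₁ ∈ A₁.carrier) (_ : f = f₀ + f₁),
    A₀.qnorm f₀ + ENNReal.ofReal t * A₁.qnorm f₁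

/-- The extremal interpolation space `(A₀, A₁)^{𝓛,𝓛}_{θ,s,c,r,b,q,a}`. -/
def llInterpolation {V : Type*} [Add V] (A₀ A₁ : QSpace V) (θ : ℝ)
    (s : ℝ≥0∞) (c : ℝ → ℝ) (r : ℝ≥0∞) (b : ℝ → ℝ) (q : ℝ≥0∞) (a : ℝ → ℝ) : QSpace V where
  carrier := {f | f ∈ sumSet A₀ A₁ ∧
    llNorm (-θ) s c r b q a (fun v => kFunctional A₀ A₁ v f) < ∞}
  qnorm f := llNorm (-θ) s c r b q a (fun v => kFunctional A₀ A₁ v f)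

section FunctionSpaces

variable {Ω : Type*} [MeasurableSpace Ω] (𝕜 : Type*) [RCLike 𝕜] (μ : Measure Ω)

variable {𝕜 μ} in
/-- The non-increasing rearrangement `f^*(t) = inf {l ≥ 0 : μ {|f| > l} ≤ t}` (with `inf ∅ = ∞`)
of a (class of a) measurable function. -/
def rearrangement (f : Ω →ₘ[μ] 𝕜) (t : ℝ) : ℝ≥0∞ :=
  sInf {l : ℝ≥0∞ | μ {x | l < ‖f x‖ₑ} ≤ ENNReal.ofReal t}

/-- The Lebesgue space `L_p`, `0 < p ≤ ∞`. -/
def lebesgueSpace (p : ℝ≥0∞) : QSpace (Ω →ₘ[μ] 𝕜) where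
  carrier := {f | eLpNorm f p μ < ∞}
  qnorm f := eLpNorm f p μ

/-- The Lorentz space `L_{p,q}`, with quasi-norm `‖ t^(1/p-1/q) f^*(t) ‖_{q,(0,∞)}`. -/
def lorentzSpace (p q : ℝ≥0∞) : QSpace (Ω →ₘ[μ] 𝕜) where
  carrier := {f | wnorm q (p⁻¹).toReal (fun _ => 1) (rearrangement f) (Ioi 0) < ∞}
  qnorm f := wnorm q (p⁻¹).toReal (fun _ => 1) (rearrangement f) (Ioi 0)

/-- The `𝓛𝓛` Lorentz–Karamata space `L^{𝓛,𝓛}_{p,(s,c,r,b,q,a)}`. -/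
def llSpace (p : ℝ≥0∞) (s : ℝ≥0∞) (c : ℝ → ℝ) (r : ℝ≥0∞) (b : ℝ → ℝ) (q : ℝ≥0∞) (a : ℝ → ℝ) :
    QSpace (Ω →ₘ[μ] 𝕜) where
  carrier := {f | llNorm (p⁻¹).toReal s c r b q a (rearrangement f) < ∞}
  qnorm f := llNorm (p⁻¹).toReal s c r b q a (rearrangement f)

end FunctionSpaces

/-- The function `t ↦ b (t ^ (1/κ))`. -/
def dil (κ : ℝ) (b : ℝ → ℝ) : ℝ → ℝ := fun t => b (t ^ (1 / κ))

end LorentzKaramata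

end

/-! Chebyshev's inequality gives `v f^*(v^κ) ≤ K(v, f; L_{κ,∞}, L_∞) ≤ K(v, f; L_κ, L_∞)` for every
`v > 0`, so it suffices to bound the quasi-norm of the last term by that of the first. Put
`X(x) = e^x f^*(e^{κx})`. Truncating `f` at the level `f^*(e^{κx})` and slicing the part above it
along the levels `f^*(e^{κ(x-j)})`, `j = 0, 1, 2, …`, yields, for every `δ > 0`,
`K(e^x, f; L_κ, L_∞) ≤ C_δ sup_j e^{δj} X(x-j)`. Since `a` is slowly varying, passing from `x` to
`x - j` multiplies the weight `e^{-θx} a(e^x)` by at least a constant times `e^{(θ-ε)j}`, which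
beats `e^{δj}`. As translating to the right does not increase norms over `(-∞, y)`, the supremum
over `j` is dominated by a convergent geometric series; no Hardy inequality enters, hence no
restriction `q ≥ 1`. This compares the innermost quasi-norms, and the two outer ones are monotone
in them. -/

open Filter Topology

namespace LorentzKaramata

section LpNorms

variable {X : Type*} [MeasurableSpace X]

theorem eLpNorm_withDensity {ν : Measure X} {q : ℝ≥0∞} (hq : q ≠ 0) {h : X → ℝ≥0∞}
    (hm : Measurable h) (h_pos : ∀ x, h x ≠ 0) (h_top : ∀ x, h x ≠ ∞) (H : X → ℝ≥0∞) :
    eLpNorm H q (ν.withDensity h) = eLpNorm (fun x => h x ^ (q⁻¹).toReal * H x) q ν := by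
  rcases eq_or_ne q ∞ with rfl | hq'
  · have hac : ν ≪ ν.withDensity h :=
      withDensity_absolutelyContinuous' hm.aemeasurable (.of_forall h_pos)
    simpa only [eLpNorm_exponent_top, eLpNormEssSup_eq_essSup_enorm, enorm_eq_self,
      ENNReal.inv_top, ENNReal.toReal_zero, ENNReal.rpow_zero, one_mul] using
      (essSup_mono_measure (withDensity_absolutelyContinuous ν h)).antisymm
        (essSup_mono_measure hac)
  · have hq0 : 0 < q.toReal := ENNReal.toReal_pos hq hq'
    simp only [eLpNorm_eq_lintegral_rpow_enorm_toReal hq hq', enorm_eq_self]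
    rw [lintegral_withDensity_eq_lintegral_mul_non_measurable ν hm
      (.of_forall fun x => (h_top x).lt_top)]
    simp only [Pi.mul_apply, ENNReal.mul_rpow_of_nonneg _ _ hq0.le, ← ENNReal.rpow_mul,
      ENNReal.toReal_inv, inv_mul_cancel₀ hq0.ne', ENNReal.rpow_one]

theorem eLpNorm_le_mul_eLpNorm_of_ae_le {ν : Measure X} {q : ℝ≥0∞} {F G : X → ℝ≥0∞} (C : ℝ≥0)
    (h : ∀ᵐ x ∂ν, F x ≤ C * G x) : eLpNorm F q ν ≤ C * eLpNorm G q ν := by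
  simpa [ENNReal.smul_def] using
    eLpNorm_le_nnreal_smul_eLpNorm_of_ae_le_mul' (f := F) (g := G) h q

theorem eLpNorm_const_mul {ν : Measure X} {C : ℝ≥0∞} (hC : C ≠ ∞) (q : ℝ≥0∞) (F : X → ℝ≥0∞) :
    eLpNorm (fun x => C * F x) q ν = C * eLpNorm F q ν := by
  rcases eq_or_ne q 0 with rfl | hq
  · simp
  rcases eq_or_ne q ∞ with rfl | hq'
  · simp [eLpNormEssSup_eq_essSup_enorm, ENNReal.essSup_const_mul]
  have hq0 : 0 < q.toReal := ENNReal.toReal_pos hq hq'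
  simp only [eLpNorm_eq_lintegral_rpow_enorm_toReal hq hq', enorm_eq_self,
    ENNReal.mul_rpow_of_nonneg _ _ hq0.le]
  rw [lintegral_const_mul' _ _ (ENNReal.rpow_ne_top_of_nonneg hq0.le hC), one_div,
    ENNReal.mul_rpow_of_nonneg _ _ (by positivity), ENNReal.rpow_rpow_inv hq0.ne']

theorem eLpNorm_top_const {ν : Measure X} (hν : ν ≠ 0) {q : ℝ≥0∞} (hq : q ≠ 0) :
    eLpNorm (fun _ : X => (∞ : ℝ≥0∞)) q ν = ∞ := by
  rw [eLpNorm_const _ hq hν, enorm_eq_self, ENNReal.top_mul]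
  simp [ENNReal.rpow_eq_zero_iff, Measure.measure_univ_eq_zero, hν, ENNReal.toReal_nonneg.not_gt]

theorem tsum_ofReal_exp_rpow_ne_top {δ r : ℝ} (hδ : 0 < δ) (hr : 0 < r) :
    ∑' j : ℕ, ENNReal.ofReal (Real.exp (-(δ * j))) ^ r ≠ ∞ := by
  have hgeom (j : ℕ) : ENNReal.ofReal (Real.exp (-(δ * j))) ^ r =
      ENNReal.ofReal (Real.exp (j * -(δ * r))) := by
    rw [ENNReal.ofReal_rpow_of_pos (Real.exp_pos _), ← Real.exp_mul]
    ring_nf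
  simp_rw [hgeom]
  exact (Real.summable_exp_nat_mul_iff.2 (by nlinarith)).tsum_ofReal_ne_top

theorem eLpNorm_iSup_rpow_le {ν : Measure X} {q : ℝ≥0∞} (hq : q ≠ 0) (hq' : q ≠ ∞)
    {F : ℕ → X → ℝ≥0∞} (hF : ∀ j, AEMeasurable (F j) ν) :
    eLpNorm (fun x => ⨆ j, F j x) q ν ^ q.toReal ≤ ∑' j, eLpNorm (F j) q ν ^ q.toReal := by
  have hq0 : 0 < q.toReal := ENNReal.toReal_pos hq hq'
  simp only [eLpNorm_eq_lintegral_rpow_enorm_toReal hq hq', enorm_eq_self, one_div,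
    ENNReal.rpow_inv_rpow hq0.ne']
  rw [← lintegral_tsum fun j => (hF j).pow_const _]
  refine lintegral_mono fun x => ?_
  rw [← ENNReal.le_rpow_inv_iff hq0]
  exact iSup_le fun j => (ENNReal.le_rpow_inv_iff hq0).2 (ENNReal.le_tsum j)

theorem exists_eLpNorm_iSup_le {δ : ℝ} (hδ : 0 < δ) {q : ℝ≥0∞} (hq : q ≠ 0) :
    ∃ C : ℝ≥0, ∀ (ν : Measure X) (F : ℕ → X → ℝ≥0∞) (N : ℝ≥0∞), (∀ j, AEMeasurable (F j) ν) →
      (∀ j : ℕ, eLpNorm (F j) q ν ≤ ENNReal.ofReal (Real.exp (-(δ * j))) * N) →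
      eLpNorm (fun x => ⨆ j, F j x) q ν ≤ C * N := by
  rcases eq_or_ne q ∞ with rfl | hq'
  · refine ⟨1, fun ν F N _ hFN => ?_⟩
    have hF (j : ℕ) : ∀ᵐ x ∂ν, F j x ≤ N := by
      filter_upwards [enorm_ae_le_eLpNormEssSup (F j) ν] with x hx
      refine (hx.trans (hFN j)).trans (mul_le_of_le_one_left' ?_)
      exact ENNReal.ofReal_le_one.2 (Real.exp_le_one_iff.2 (by rw [neg_nonpos]; positivity))
    rw [ENNReal.coe_one, one_mul, eLpNorm_exponent_top, eLpNormEssSup_eq_essSup_enorm]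
    exact essSup_le_of_ae_le _ ((ae_all_iff.2 hF).mono fun x hx => iSup_le hx)
  · have hq0 : 0 < q.toReal := ENNReal.toReal_pos hq hq'
    set S := ∑' j : ℕ, ENNReal.ofReal (Real.exp (-(δ * j))) ^ q.toReal
    have hS : S ^ q.toReal⁻¹ ≠ ∞ :=
      ENNReal.rpow_ne_top_of_nonneg (by positivity) (tsum_ofReal_exp_rpow_ne_top hδ hq0)
    refine ⟨(S ^ q.toReal⁻¹).toNNReal, fun ν F N hF hFN => ?_⟩
    rw [ENNReal.coe_toNNReal hS, ← ENNReal.rpow_le_rpow_iff hq0,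
      ENNReal.mul_rpow_of_nonneg _ _ hq0.le, ENNReal.rpow_inv_rpow hq0.ne',
      ← ENNReal.tsum_mul_right]
    refine (eLpNorm_iSup_rpow_le hq hq' hF).trans (ENNReal.tsum_le_tsum fun j => ?_)
    rw [← ENNReal.mul_rpow_of_nonneg _ _ hq0.le]
    exact ENNReal.rpow_le_rpow (hFN j) hq0.le

end LpNorms

theorem mul_le_essSup_mul_of_antitone {g F : ℝ → ℝ≥0∞} (hg : Continuous g) (hF : Antitone F)
    (x : ℝ) : g x * F x ≤ essSup (fun y => g y * F y) volume := by
  set N := essSup (fun y => g y * F y) volume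
  by_contra! hlt
  have hlim : Tendsto (fun y => g y * F x) (𝓝 x) (𝓝 (g x * F x)) :=
    ENNReal.Tendsto.mul_const (hg.tendsto x) (.inl fun h => by simp [h] at hlt)
  obtain ⟨y, hyx, hy⟩ := exists_Ioc_subset_of_mem_nhds (hlim.eventually (lt_mem_nhds hlt))
    (exists_lt x)
  have hnull : volume (Ioo y x) = 0 :=
    measure_mono_null (fun z hz => (hy (Ioo_subset_Ioc_self hz)).trans_le
      (mul_le_mul_right (hF hz.2.le) _)) (meas_essSup_lt (f := fun y => g y * F y))
  simp [hyx.not_ge] at hnull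

section LogCoordinates

theorem map_exp_withDensity_exp {S : Set ℝ} (hS : MeasurableSet S) :
    ((volume.restrict S).withDensity fun x => ENNReal.ofReal (Real.exp x)).map Real.exp =
      volume.restrict (Real.exp '' S) := by
  simpa [ContinuousLinearMap.det_toSpanSingleton, abs_of_pos (Real.exp_pos _)] using
    map_withDensity_abs_det_fderiv_eq_addHaar volume hS.nullMeasurableSet
      (fun x _ => (Real.hasDerivAt_exp x).hasFDerivAt.hasFDerivWithinAt) Real.exp_injective.injOn

theorem wnorm_image_exp {q : ℝ≥0∞} (hq : q ≠ 0) (α : ℝ) (w : ℝ → ℝ) (F : ℝ → ℝ≥0∞) {S : Set ℝ}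
    (hS : MeasurableSet S) :
    wnorm q α w F (Real.exp '' S) =
      eLpNorm (fun x => ENNReal.ofReal (Real.exp (α * x) * w (Real.exp x)) * F (Real.exp x)) q
        (volume.restrict S) := by
  rw [wnorm, ← map_exp_withDensity_exp hS,
    Real.isOpenEmbedding_exp.measurableEmbedding.eLpNorm_map_measure,
    eLpNorm_withDensity hq (by fun_prop) (by simp [Real.exp_pos]) (by simp)]
  congr 1 with x
  rw [Function.comp_apply, ENNReal.ofReal_rpow_of_pos (Real.exp_pos x), ← mul_assoc,
    ← ENNReal.ofReal_mul (by positivity), ← mul_assoc, ← Real.exp_mul, ← Real.exp_mul,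
    ← Real.exp_add]
  ring_nf

theorem image_exp_Iio (y : ℝ) : Real.exp '' Iio y = Ioo 0 (Real.exp y) := by
  ext t
  refine ⟨?_, fun ht => ⟨Real.log t, (Real.log_lt_iff_lt_exp ht.1).2 ht.2, Real.exp_log ht.1⟩⟩
  rintro ⟨x, hx, rfl⟩
  exact ⟨Real.exp_pos x, Real.exp_lt_exp.2 hx⟩

theorem eLpNorm_comp_mul_left {κ : ℝ} (hκ : 0 < κ) (q : ℝ≥0∞) (H : ℝ → ℝ≥0∞)
    (S : Set ℝ) :
    eLpNorm (fun x => H (κ * x)) q (volume.restrict ((κ * ·) ⁻¹' S)) =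
      ENNReal.ofReal κ⁻¹ ^ (q⁻¹).toReal * eLpNorm H q (volume.restrict S) := by
  have hemb : MeasurableEmbedding (κ * · : ℝ → ℝ) := measurableEmbedding_mulLeft₀ hκ.ne'
  have h := hemb.eLpNorm_map_measure (g := H) (p := q) (μ := volume.restrict ((κ * ·) ⁻¹' S))
  rw [← hemb.restrict_map, Real.map_volume_mul_left hκ.ne', abs_of_pos (inv_pos.2 hκ),
    Measure.restrict_smul, eLpNorm_smul_measure_of_ne_zero (by simpa using hκ), one_div] at h
  exact h.symm

theorem wnorm_comp_rpow {q : ℝ≥0∞} (hq : q ≠ 0) {κ : ℝ} (hκ : 0 < κ) (α : ℝ) (w : ℝ → ℝ)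
    (F : ℝ → ℝ≥0∞) {S : Set ℝ} (hS : MeasurableSet S) :
    wnorm q α w (fun t => F (t ^ κ)) (Real.exp '' ((κ * ·) ⁻¹' S)) =
      ENNReal.ofReal κ⁻¹ ^ (q⁻¹).toReal * wnorm q (α / κ) (dil κ w) F (Real.exp '' S) := by
  rw [wnorm_image_exp hq _ _ _ hS, ← eLpNorm_comp_mul_left hκ,
    wnorm_image_exp hq _ _ _ (hS.preimage (measurable_const_mul κ))]
  congr 1 with x
  rw [dil, ← Real.exp_mul, ← Real.exp_mul, mul_comm x, div_mul_eq_mul_div, mul_left_comm,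
    mul_div_cancel_left₀ _ hκ.ne', mul_right_comm, mul_one_div_cancel hκ.ne', one_mul]

theorem wnorm_comp_rpow_Ioi {q : ℝ≥0∞} (hq : q ≠ 0) {κ : ℝ} (hκ : 0 < κ) (α : ℝ) (w : ℝ → ℝ)
    (F : ℝ → ℝ≥0∞) :
    wnorm q α w (fun t => F (t ^ κ)) (Ioi 0) =
      ENNReal.ofReal κ⁻¹ ^ (q⁻¹).toReal * wnorm q (α / κ) (dil κ w) F (Ioi 0) := by
  simpa using wnorm_comp_rpow hq hκ α w F MeasurableSet.univ

theorem wnorm_comp_rpow_Ioo {q : ℝ≥0∞} (hq : q ≠ 0) {κ : ℝ} (hκ : 0 < κ) (α : ℝ) (w : ℝ → ℝ)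
    (F : ℝ → ℝ≥0∞) {u : ℝ} (hu : 0 < u) :
    wnorm q α w (fun t => F (t ^ κ)) (Ioo 0 u) =
      ENNReal.ofReal κ⁻¹ ^ (q⁻¹).toReal * wnorm q (α / κ) (dil κ w) F (Ioo 0 (u ^ κ)) := by
  have h := wnorm_comp_rpow hq hκ α w F (measurableSet_Iio (a := κ * Real.log u))
  rwa [preimage_const_mul_Iio₀ _ hκ, mul_div_cancel_left₀ _ hκ.ne', image_exp_Iio, image_exp_Iio,
    mul_comm κ, Real.exp_mul, Real.exp_log hu] at h

end LogCoordinates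

section IteratedNorms

theorem wnorm_mono {q : ℝ≥0∞} {α : ℝ} {w : ℝ → ℝ} {F G : ℝ → ℝ≥0∞} {I : Set ℝ}
    (hI : MeasurableSet I) (C : ℝ≥0) (h : ∀ t ∈ I, F t ≤ C * G t) :
    wnorm q α w F I ≤ C * wnorm q α w G I := by
  refine eLpNorm_le_mul_eLpNorm_of_ae_le C ?_
  filter_upwards [ae_restrict_mem hI] with t ht
  rw [mul_left_comm]
  exact mul_le_mul_right (h t ht) _

theorem wnorm_congr {q : ℝ≥0∞} {α : ℝ} {w : ℝ → ℝ} {F G : ℝ → ℝ≥0∞} {I : Set ℝ}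
    (hI : MeasurableSet I) (h : EqOn F G I) : wnorm q α w F I = wnorm q α w G I :=
  eLpNorm_congr_ae <| (ae_restrict_mem hI).mono fun _ ht => congrArg _ (h ht)

theorem wnorm_const_mul {C : ℝ≥0∞} (hC : C ≠ ∞) (q : ℝ≥0∞) (α : ℝ) (w : ℝ → ℝ) (F : ℝ → ℝ≥0∞)
    (I : Set ℝ) : wnorm q α w (fun t => C * F t) I = C * wnorm q α w F I := by
  simp only [wnorm, mul_left_comm _ C]
  exact eLpNorm_const_mul hC q _

theorem wnorm_mul_ofReal (q : ℝ≥0∞) (α : ℝ) (w : ℝ → ℝ) (F : ℝ → ℝ≥0∞) {I : Set ℝ}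
    (hI : MeasurableSet I) (hI0 : I ⊆ Ioi 0) :
    wnorm q α w (fun t => ENNReal.ofReal t * F t) I = wnorm q (α + 1) w F I := by
  refine eLpNorm_congr_ae ((ae_restrict_mem hI).mono fun t ht => ?_)
  have ht0 : 0 < t := hI0 ht
  simp only
  rw [← mul_assoc, ← ENNReal.ofReal_mul' ht0.le, add_sub_right_comm, Real.rpow_add_one ht0.ne',
    mul_right_comm]

theorem wnorm_top {q : ℝ≥0∞} (hq : q ≠ 0) (α : ℝ) {w : ℝ → ℝ} {I : Set ℝ} (hI : MeasurableSet I)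
    (hI0 : I ⊆ Ioi 0) (hIv : volume I ≠ 0) (hw : ∀ t, 0 < t → 0 < w t) :
    wnorm q α w (fun _ => ∞) I = ∞ := by
  refine Eq.trans ?_ (eLpNorm_top_const (ν := volume.restrict I) (by simpa using hIv) hq)
  refine eLpNorm_congr_ae ((ae_restrict_mem hI).mono fun t ht => ?_)
  have ht0 : 0 < t := hI0 ht
  exact ENNReal.mul_top (ENNReal.ofReal_pos.2 (mul_pos (by positivity) (hw t ht0))).ne'

variable {s r q : ℝ≥0∞} {α : ℝ} {c b a : ℝ → ℝ} {F G : ℝ → ℝ≥0∞}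

theorem llNorm_le_mul_of_wnorm_le (C : ℝ≥0)
    (h : ∀ u, 0 < u → wnorm q α a F (Ioo 0 u) ≤ C * wnorm q α a G (Ioo 0 u)) :
    llNorm α s c r b q a F ≤ C * llNorm α s c r b q a G :=
  wnorm_mono measurableSet_Ioi C fun _ _ => wnorm_mono measurableSet_Ioo C fun u hu => h u hu.1

theorem llNorm_mono (h : ∀ t, 0 < t → F t ≤ G t) :
    llNorm α s c r b q a F ≤ llNorm α s c r b q a G := by
  simpa using llNorm_le_mul_of_wnorm_le (s := s) (r := r) (c := c) (b := b) 1 fun u _ =>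
    wnorm_mono (q := q) (α := α) (w := a) (F := F) (G := G) measurableSet_Ioo 1 fun t ht => by
      simpa using h t ht.1

theorem llNorm_top (hs : s ≠ 0) (hr : r ≠ 0) (hq : q ≠ 0) (hc : ∀ t, 0 < t → 0 < c t)
    (hb : ∀ t, 0 < t → 0 < b t) (ha : ∀ t, 0 < t → 0 < a t) :
    llNorm α s c r b q a (fun _ => ∞) = ∞ := by
  have hIoo {u : ℝ} (hu : 0 < u) : volume (Ioo 0 u) ≠ 0 := by simpa using hu
  have hq_top : EqOn (fun u => wnorm q α a (fun _ => ∞) (Ioo 0 u)) (fun _ => ∞) (Ioi 0) :=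
    fun u hu => wnorm_top hq α measurableSet_Ioo Ioo_subset_Ioi_self (hIoo hu) ha
  have hr_top : EqOn (fun t => wnorm r 0 b (fun u => wnorm q α a (fun _ => ∞) (Ioo 0 u)) (Ioo 0 t))
      (fun _ => ∞) (Ioi 0) := fun t ht =>
    (wnorm_congr measurableSet_Ioo (hq_top.mono Ioo_subset_Ioi_self)).trans
      (wnorm_top hr 0 measurableSet_Ioo Ioo_subset_Ioi_self (hIoo ht) hb)
  exact (wnorm_congr measurableSet_Ioi hr_top).trans
    (wnorm_top hs 0 measurableSet_Ioi subset_rfl (by simp) hc)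

theorem llNorm_mul_ofReal :
    llNorm α s c r b q a (fun v => ENNReal.ofReal v * F v) = llNorm (α + 1) s c r b q a F := by
  simp only [llNorm, wnorm_mul_ofReal _ _ _ _ measurableSet_Ioo Ioo_subset_Ioi_self]

theorem llNorm_comp_rpow (hs : s ≠ 0) (hr : r ≠ 0) (hq : q ≠ 0) {κ : ℝ} (hκ : 0 < κ) :
    llNorm α s c r b q a (fun v => F (v ^ κ)) =
      ENNReal.ofReal κ⁻¹ ^ ((q⁻¹).toReal + (r⁻¹).toReal + (s⁻¹).toReal) *
        llNorm (α / κ) s (dil κ c) r (dil κ b) q (dil κ a) F := by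
  have hk : ENNReal.ofReal κ⁻¹ ≠ 0 := by simpa using hκ
  set k : ℝ≥0∞ → ℝ≥0∞ := fun x => ENNReal.ofReal κ⁻¹ ^ (x⁻¹).toReal
  have hk_top (x : ℝ≥0∞) : k x ≠ ∞ :=
    ENNReal.rpow_ne_top_of_nonneg ENNReal.toReal_nonneg ENNReal.ofReal_ne_top
  set Q : ℝ → ℝ≥0∞ := fun u => wnorm q (α / κ) (dil κ a) F (Ioo 0 u)
  set R : ℝ → ℝ≥0∞ := fun t => wnorm r 0 (dil κ b) Q (Ioo 0 t)
  have hQ (u : ℝ) (hu : 0 < u) : wnorm q α a (fun v => F (v ^ κ)) (Ioo 0 u) = k q * Q (u ^ κ) :=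
    wnorm_comp_rpow_Ioo hq hκ α a F hu
  have hR (t : ℝ) (ht : 0 < t) :
      wnorm r 0 b (fun u => wnorm q α a (fun v => F (v ^ κ)) (Ioo 0 u)) (Ioo 0 t) =
        k q * k r * R (t ^ κ) := by
    rw [wnorm_congr measurableSet_Ioo fun u hu => hQ u hu.1, wnorm_const_mul (hk_top q),
      wnorm_comp_rpow_Ioo hr hκ _ _ _ ht, zero_div, mul_assoc]
  calc llNorm α s c r b q a (fun v => F (v ^ κ))
      = wnorm s 0 c (fun t => k q * k r * R (t ^ κ)) (Ioi 0) := wnorm_congr measurableSet_Ioi hR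
    _ = k q * k r * (k s * wnorm s 0 (dil κ c) R (Ioi 0)) := by
      rw [wnorm_const_mul (ENNReal.mul_ne_top (hk_top q) (hk_top r)),
        wnorm_comp_rpow_Ioi hs hκ, zero_div]
    _ = _ := by
      rw [ENNReal.rpow_add _ _ hk ENNReal.ofReal_ne_top,
        ENNReal.rpow_add _ _ hk ENNReal.ofReal_ne_top, ← mul_assoc]
      rfl

end IteratedNorms

section KFunctional

variable {V : Type*} [Add V] {A₀ A₁ B₀ : QSpace V}

theorem kFunctional_le {f₀ f₁ : V} (h₀ : f₀ ∈ A₀.carrier) (h₁ : f₁ ∈ A₁.carrier) (t : ℝ) :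
    kFunctional A₀ A₁ t (f₀ + f₁) ≤ A₀.qnorm f₀ + ENNReal.ofReal t * A₁.qnorm f₁ :=
  iInf_le_of_le f₀ <| iInf_le_of_le h₀ <| iInf_le_of_le f₁ <| iInf_le_of_le h₁ <|
    iInf_le_of_le rfl le_rfl

theorem le_kFunctional {t : ℝ} {f : V} {k : ℝ≥0∞}
    (h : ∀ f₀ ∈ A₀.carrier, ∀ f₁ ∈ A₁.carrier, f = f₀ + f₁ →
      k ≤ A₀.qnorm f₀ + ENNReal.ofReal t * A₁.qnorm f₁) :
    k ≤ kFunctional A₀ A₁ t f :=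
  le_iInf₂ fun f₀ h₀ => le_iInf₂ fun f₁ h₁ => le_iInf fun hf => h f₀ h₀ f₁ h₁ hf

theorem kFunctional_mono_left (hsub : B₀.carrier ⊆ A₀.carrier)
    (hnorm : ∀ f, A₀.qnorm f ≤ B₀.qnorm f) (t : ℝ) (f : V) :
    kFunctional A₀ A₁ t f ≤ kFunctional B₀ A₁ t f :=
  le_kFunctional fun f₀ h₀ _ h₁ hf =>
    hf ▸ (kFunctional_le (hsub h₀) h₁ t).trans (add_le_add_left (hnorm f₀) _)

theorem kFunctional_eq_top {f : V} (hf : f ∉ sumSet A₀ A₁) (t : ℝ) : kFunctional A₀ A₁ t f = ∞ :=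
  top_le_iff.1 <| le_kFunctional fun f₀ h₀ f₁ h₁ h => absurd ⟨f₀, h₀, f₁, h₁, h⟩ hf

end KFunctional

section Rearrangement

variable {Ω : Type*} [MeasurableSpace Ω] {𝕜 : Type*} [RCLike 𝕜] {μ : Measure Ω}

theorem rearrangement_antitone (f : Ω →ₘ[μ] 𝕜) : Antitone (rearrangement f) := fun _ _ h =>
  sInf_le_sInf fun _ hl => le_trans hl (ENNReal.ofReal_le_ofReal h)

theorem rearrangement_le {f : Ω →ₘ[μ] 𝕜} {t : ℝ} {l : ℝ≥0∞}
    (h : μ {x | l < ‖f x‖ₑ} ≤ ENNReal.ofReal t) : rearrangement f t ≤ l :=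
  sInf_le h

theorem measure_rearrangement_lt_le (f : Ω →ₘ[μ] 𝕜) (t : ℝ) :
    μ {x | rearrangement f t < ‖f x‖ₑ} ≤ ENNReal.ofReal t := by
  obtain ⟨l, hl, hlim, hmem⟩ := exists_seq_tendsto_sInf
    (S := {l : ℝ≥0∞ | μ {x | l < ‖f x‖ₑ} ≤ ENNReal.ofReal t}) ⟨∞, by simp⟩ (OrderBot.bddBelow _)
  have hUnion : {x | rearrangement f t < ‖f x‖ₑ} = ⋃ n, {x | l n < ‖f x‖ₑ} := by
    ext x
    simp only [mem_ofPred_eq, mem_iUnion]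
    exact ⟨fun hx => (hlim.eventually_lt_const hx).exists,
      fun ⟨n, hn⟩ => (rearrangement_le (hmem n)).trans_lt hn⟩
  have hmono : Monotone fun n => {x | l n < ‖f x‖ₑ} := fun m n hmn x hx =>
    (hl hmn).trans_lt hx
  rw [hUnion, hmono.measure_iUnion]
  exact iSup_le hmem

theorem rearrangement_add_le (f g : Ω →ₘ[μ] 𝕜) (t : ℝ) :
    rearrangement (f + g) t ≤ rearrangement f t + eLpNorm g ∞ μ := by
  refine rearrangement_le ((measure_mono_ae ?_).trans (measure_rearrangement_lt_le f t))
  filter_upwards [AEEqFun.coeFn_add f g, enorm_ae_le_eLpNormEssSup g μ] with x hx hg hlt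
  change _ < ‖(f + g) x‖ₑ at hlt
  rw [hx, Pi.add_apply, eLpNorm_exponent_top] at hlt
  exact lt_of_add_lt_add_right (hlt.trans_le ((enorm_add_le _ _).trans (add_le_add_right hg _)))

theorem rpow_mul_rearrangement_le_eLpNorm {p : ℝ≥0∞} (hp : p ≠ 0) (hp' : p ≠ ∞) (f : Ω →ₘ[μ] 𝕜)
    (t : ℝ) : ENNReal.ofReal t ^ p.toReal⁻¹ * rearrangement f t ≤ eLpNorm f p μ := by
  have hp0 : 0 < p.toReal := ENNReal.toReal_pos hp hp'
  refine ENNReal.mul_le_of_forall_lt fun y hy l hl => ?_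
  have hlevel : ENNReal.ofReal t ≤ μ {x | l ≤ ‖f x‖ₑ} := by
    by_contra! hlt
    exact hl.not_ge (rearrangement_le
      ((measure_mono fun x (hx : l < ‖f x‖ₑ) => hx.le).trans hlt.le))
  rw [← ENNReal.rpow_le_rpow_iff hp0]
  calc (y * l) ^ p.toReal ≤ (ENNReal.ofReal t ^ p.toReal⁻¹ * l) ^ p.toReal := by gcongr
    _ = l ^ p.toReal * ENNReal.ofReal t := by
      rw [ENNReal.mul_rpow_of_nonneg _ _ hp0.le, ENNReal.rpow_inv_rpow hp0.ne', mul_comm]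
    _ ≤ l ^ p.toReal * μ {x | l ≤ ‖f x‖ₑ} := by gcongr
    _ ≤ eLpNorm f p μ ^ p.toReal :=
      mul_meas_ge_le_pow_eLpNorm' μ hp hp' f.aestronglyMeasurable l

theorem measure_forall_rearrangement_lt_eq_zero (f : Ω →ₘ[μ] 𝕜) {t : ℕ → ℝ}
    (ht : Tendsto t atTop (𝓝 0)) : μ {x | ∀ j, rearrangement f (t j) < ‖f x‖ₑ} = 0 := by
  have hlim : Tendsto (fun j => ENNReal.ofReal (t j)) atTop (𝓝 0) := by
    simpa using ENNReal.tendsto_ofReal ht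
  exact nonpos_iff_eq_zero.1 <| ge_of_tendsto' hlim fun j =>
    (measure_mono fun x (hx : ∀ j, rearrangement f (t j) < ‖f x‖ₑ) => hx j).trans
      (measure_rearrangement_lt_le f (t j))

theorem lintegral_rearrangement_lt_le (f : Ω →ₘ[μ] 𝕜) {t : ℕ → ℝ} (ht : Tendsto t atTop (𝓝 0))
    {r : ℝ} (hr : 0 ≤ r) :
    ∫⁻ x in {x | rearrangement f (t 0) < ‖f x‖ₑ}, ‖f x‖ₑ ^ r ∂μ ≤
      ∑' j, rearrangement f (t (j + 1)) ^ r * ENNReal.ofReal (t j) := by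
  set L : ℕ → ℝ≥0∞ := fun j => rearrangement f (t j)
  set E : ℕ → Set Ω := fun j => {x | L j < ‖f x‖ₑ ∧ ‖f x‖ₑ ≤ L (j + 1)}
  set N : Set Ω := {x | ∀ j, L j < ‖f x‖ₑ}
  have hE (j : ℕ) : MeasurableSet (E j) :=
    (measurableSet_lt measurable_const f.measurable.enorm).inter
      (measurableSet_le f.measurable.enorm measurable_const)
  have hcover : {x | L 0 < ‖f x‖ₑ} ⊆ (⋃ j, E j) ∪ N := by
    refine fun x hx => or_iff_not_imp_left.2 fun hxE j => ?_
    induction j with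
    | zero => exact hx
    | succ j ih => exact not_le.1 fun hle => hxE (mem_iUnion.2 ⟨j, ih, hle⟩)
  calc ∫⁻ x in {x | L 0 < ‖f x‖ₑ}, ‖f x‖ₑ ^ r ∂μ
      ≤ ∫⁻ x in (⋃ j, E j) ∪ N, ‖f x‖ₑ ^ r ∂μ := lintegral_mono_set hcover
    _ ≤ ∫⁻ x in ⋃ j, E j, ‖f x‖ₑ ^ r ∂μ + ∫⁻ x in N, ‖f x‖ₑ ^ r ∂μ := lintegral_union_le _ _ _
    _ = ∫⁻ x in ⋃ j, E j, ‖f x‖ₑ ^ r ∂μ := by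
      rw [setLIntegral_measure_zero _ _ (measure_forall_rearrangement_lt_eq_zero f ht), add_zero]
    _ ≤ ∑' j, ∫⁻ x in E j, ‖f x‖ₑ ^ r ∂μ := lintegral_iUnion_le _ _
    _ ≤ ∑' j, ∫⁻ _ in E j, L (j + 1) ^ r ∂μ := ENNReal.tsum_le_tsum fun j =>
      setLIntegral_mono' (hE j) fun x hx => ENNReal.rpow_le_rpow hx.2 hr
    _ ≤ ∑' j, L (j + 1) ^ r * ENNReal.ofReal (t j) := ENNReal.tsum_le_tsum fun j => by
      rw [setLIntegral_const]
      gcongr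
      exact (measure_mono fun x hx => hx.1).trans (measure_rearrangement_lt_le f (t j))

theorem kFunctional_lebesgue_le_truncation (p : ℝ≥0∞) (f : Ω →ₘ[μ] 𝕜) {v : ℝ} (hv : 0 < v)
    (L : ℝ≥0∞) :
    kFunctional (lebesgueSpace 𝕜 μ p) (lebesgueSpace 𝕜 μ ∞) v f ≤
      eLpNorm f p (μ.restrict {x | L < ‖f x‖ₑ}) + ENNReal.ofReal v * L := by
  set A : Set Ω := {x | L < ‖f x‖ₑ}
  have hA : MeasurableSet A := measurableSet_lt measurable_const f.measurable.enorm
  have hm₀ : AEStronglyMeasurable (A.indicator f) μ := f.aestronglyMeasurable.indicator hA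
  have hm₁ : AEStronglyMeasurable (Aᶜ.indicator f) μ := f.aestronglyMeasurable.indicator hA.compl
  have hsum : AEEqFun.mk _ hm₀ + AEEqFun.mk _ hm₁ = f := by
    rw [AEEqFun.mk_add_mk]
    simp only [indicator_self_add_compl, AEEqFun.mk_coeFn]
  have hnorm₀ : eLpNorm (AEEqFun.mk _ hm₀) p μ = eLpNorm f p (μ.restrict A) := by
    rw [eLpNorm_congr_ae (AEEqFun.coeFn_mk _ hm₀), eLpNorm_indicator_eq_eLpNorm_restrict hA]
  have hnorm₁ : eLpNorm (AEEqFun.mk _ hm₁) ∞ μ ≤ L := by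
    rw [eLpNorm_congr_ae (AEEqFun.coeFn_mk _ hm₁), eLpNorm_indicator_eq_eLpNorm_restrict hA.compl,
      eLpNorm_exponent_top, eLpNormEssSup_eq_essSup_enorm]
    exact essSup_le_of_ae_le _ ((ae_restrict_mem hA.compl).mono fun x hx => not_lt.1 hx)
  rcases eq_or_ne (eLpNorm f p (μ.restrict A) + ENNReal.ofReal v * L) ∞ with htop | htop
  · exact le_top.trans_eq htop.symm
  have hL : L ≠ ∞ := by
    rintro rfl
    simp [ENNReal.mul_top, hv] at htop
  rw [← hnorm₀] at htop ⊢
  have h := kFunctional_le (A₀ := lebesgueSpace 𝕜 μ p) (A₁ := lebesgueSpace 𝕜 μ ∞)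
    (ENNReal.add_ne_top.1 htop).1.lt_top (hnorm₁.trans_lt hL.lt_top) v
  rw [hsum] at h
  exact h.trans (add_le_add_right (mul_le_mul_right hnorm₁ _) _)

end Rearrangement

section Hardy

/-- `φ` is almost decreasing on `(0,∞)`, i.e. equivalent there to a non-increasing function. Values
outside `(0,∞)` are irrelevant. -/
def AlmostDecreasing (φ : ℝ → ℝ) : Prop :=
  ∃ C : ℝ≥0, ∀ s t, 0 < s → s ≤ t → φ t ≤ C * φ s

theorem SlowlyVarying.almostDecreasing {b : ℝ → ℝ} (hb : SlowlyVarying b) {ε : ℝ} (hε : 0 < ε) :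
    AlmostDecreasing fun t => t ^ (-ε) * b t := by
  obtain ⟨g, C, hg, hC, hbg⟩ := hb.equiv_anti ε hε
  lift C to ℝ≥0 using hC.le
  refine ⟨C * C, fun s t hs hst => ?_⟩
  have ht : 0 < t := hs.trans_le hst
  calc t ^ (-ε) * b t ≤ C * g t := (hbg t ht).1
    _ ≤ C * g s := by gcongr; exact hg hs ht hst
    _ ≤ C * (C * (s ^ (-ε) * b s)) := by gcongr; exact (hbg s hs).2
    _ = _ := by push_cast; ring

theorem aemeasurable_comp_exp {w : ℝ → ℝ} (hw : AEMeasurable w (volume.restrict (Ioi 0))) :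
    AEMeasurable (fun x => w (Real.exp x)) volume := by
  have hmap := map_exp_withDensity_exp MeasurableSet.univ
  rw [image_univ, Real.range_exp, Measure.restrict_univ] at hmap
  rw [← hmap, Real.isOpenEmbedding_exp.measurableEmbedding.aemeasurable_map_iff] at hw
  exact hw.mono_ac (withDensity_absolutelyContinuous' (by fun_prop) (by simp [Real.exp_pos]))

theorem eLpNorm_comp_sub_Iio_le (q : ℝ≥0∞) (H : ℝ → ℝ≥0∞) {h : ℝ} (hh : 0 ≤ h) (y : ℝ) :
    eLpNorm (fun x => H (x - h)) q (volume.restrict (Iio y)) ≤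
      eLpNorm H q (volume.restrict (Iio y)) := by
  have hemb : MeasurableEmbedding (· - h : ℝ → ℝ) := measurableEmbedding_subRight h
  have hpre : (· - h) ⁻¹' Iio (y - h) = Iio y := by ext; simp
  calc eLpNorm (fun x => H (x - h)) q (volume.restrict (Iio y))
      = eLpNorm H q ((volume.restrict (Iio y)).map (· - h)) :=
        (hemb.eLpNorm_map_measure (g := H)).symm
    _ = eLpNorm H q (volume.restrict (Iio (y - h))) := by
      rw [← hpre, ← hemb.restrict_map, (measurePreserving_sub_right volume h).map_eq]
    _ ≤ _ := eLpNorm_mono_measure _ (Measure.restrict_mono (Iio_subset_Iio (by linarith)) le_rfl)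

theorem exists_eLpNorm_Iio_le_of_le_iSup {η : ℝ} (hη : 0 < η) {q : ℝ≥0∞} (hq : q ≠ 0) :
    ∃ C : ℝ≥0, ∀ Φ H : ℝ → ℝ≥0∞, AEMeasurable H volume →
      (∀ x, Φ x ≤ ⨆ j : ℕ, ENNReal.ofReal (Real.exp (-(η * j))) * H (x - j)) →
      ∀ y, eLpNorm Φ q (volume.restrict (Iio y)) ≤ C * eLpNorm H q (volume.restrict (Iio y)) := by
  obtain ⟨C, hC⟩ := exists_eLpNorm_iSup_le (X := ℝ) hη hq
  refine ⟨C, fun Φ H hH hΦ y => (eLpNorm_mono_enorm hΦ).trans (hC _ _ _ (fun j => ?_) fun j => ?_)⟩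
  · exact ((hH.comp_quasiMeasurePreserving
      (measurePreserving_sub_right volume (j : ℝ)).quasiMeasurePreserving).const_mul _).restrict
  · rw [eLpNorm_const_mul ENNReal.ofReal_ne_top]
    gcongr
    exact eLpNorm_comp_sub_Iio_le q H j.cast_nonneg y

theorem AlmostDecreasing.exists_exp_mul_le {a : ℝ → ℝ} {ε : ℝ}
    (ha : AlmostDecreasing fun t => t ^ (-ε) * a t) (θ : ℝ) :
    ∃ D : ℝ≥0, ∀ x h, 0 ≤ h → Real.exp (-θ * x) * a (Real.exp x) ≤
      Real.exp (-((θ - ε) * h)) * (D * (Real.exp (-θ * (x - h)) * a (Real.exp (x - h)))) := by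
  obtain ⟨D, hD⟩ := ha
  refine ⟨D, fun x h hh => ?_⟩
  have hx := hD (Real.exp (x - h)) (Real.exp x) (Real.exp_pos _)
    (Real.exp_le_exp.2 (sub_le_self x hh))
  simp only [← Real.exp_mul] at hx
  calc Real.exp (-θ * x) * a (Real.exp x)
      = Real.exp (-(θ - ε) * x) * (Real.exp (x * -ε) * a (Real.exp x)) := by
        rw [← mul_assoc, ← Real.exp_add]; ring_nf
    _ ≤ Real.exp (-(θ - ε) * x) * (D * (Real.exp ((x - h) * -ε) * a (Real.exp (x - h)))) := by
        gcongr
    _ = D * (Real.exp (-(θ - ε) * x) * Real.exp ((x - h) * -ε) * a (Real.exp (x - h))) := by ring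
    _ = D * (Real.exp (-((θ - ε) * h)) * Real.exp (-θ * (x - h)) * a (Real.exp (x - h))) := by
        rw [← Real.exp_add, ← Real.exp_add]; ring_nf
    _ = _ := by ring

theorem exists_wnorm_le_of_le_iSup {q : ℝ≥0∞} (hq : q ≠ 0) {θ ε δ : ℝ} (hθ : ε + δ < θ)
    {a : ℝ → ℝ} (ham : AEMeasurable a (volume.restrict (Ioi 0)))
    (ha : AlmostDecreasing fun t => t ^ (-ε) * a t) :
    ∃ C : ℝ≥0, ∀ F G : ℝ → ℝ≥0∞, Measurable G →
      (∀ x, F (Real.exp x) ≤ ⨆ j : ℕ, ENNReal.ofReal (Real.exp (δ * j)) * G (Real.exp (x - j))) →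
      ∀ u, 0 < u → wnorm q (-θ) a F (Ioo 0 u) ≤ C * wnorm q (-θ) a G (Ioo 0 u) := by
  obtain ⟨D, hD⟩ := ha.exists_exp_mul_le θ
  obtain ⟨C, hC⟩ := exists_eLpNorm_Iio_le_of_le_iSup (sub_pos.2 hθ) hq
  refine ⟨C * D, fun F G hG hFG u hu => ?_⟩
  obtain ⟨y, rfl⟩ : ∃ y, Real.exp y = u := ⟨Real.log u, Real.exp_log hu⟩
  set W : ℝ → ℝ := fun x => Real.exp (-θ * x) * a (Real.exp x)
  have hWm : AEMeasurable W volume :=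
    AEMeasurable.mul (by fun_prop) (aemeasurable_comp_exp ham)
  have hH : AEMeasurable (fun x => D * (ENNReal.ofReal (W x) * G (Real.exp x))) volume :=
    (hWm.ennreal_ofReal.mul (hG.comp Real.measurable_exp).aemeasurable).const_mul _
  rw [← image_exp_Iio, wnorm_image_exp hq _ _ _ measurableSet_Iio,
    wnorm_image_exp hq _ _ _ measurableSet_Iio, ENNReal.coe_mul, mul_assoc,
    ← eLpNorm_const_mul ENNReal.coe_ne_top]
  refine hC _ _ hH (fun x => ?_) y
  refine (mul_le_mul_right (hFG x) _).trans ?_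
  rw [ENNReal.mul_iSup]
  refine iSup_mono fun j => ?_
  have hexp : -((θ - (ε + δ)) * j) = -((θ - ε) * j) + δ * j := by ring
  calc ENNReal.ofReal (W x) * (ENNReal.ofReal (Real.exp (δ * j)) * G (Real.exp (x - j)))
      ≤ ENNReal.ofReal (Real.exp (-((θ - ε) * j)) * (D * W (x - j))) *
          (ENNReal.ofReal (Real.exp (δ * j)) * G (Real.exp (x - j))) := by
        gcongr
        exact hD x j j.cast_nonneg
    _ = _ := by
        rw [hexp, Real.exp_add, ENNReal.ofReal_mul (Real.exp_nonneg _),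
          ENNReal.ofReal_mul (Real.exp_nonneg _), ENNReal.ofReal_mul D.coe_nonneg,
          ENNReal.ofReal_coe_nnreal]
        ring

end Hardy

section KFunctionalEstimates

variable {Ω : Type*} [MeasurableSpace Ω] {𝕜 : Type*} [RCLike 𝕜] {μ : Measure Ω}

/-- The function `v ↦ v * f^*(v ^ κ)`, which plays the role of `K(v, f; L_{κ,∞}, L_∞)`. -/
noncomputable def scaledRearrangement (κ : ℝ) (f : Ω →ₘ[μ] 𝕜) (v : ℝ) : ℝ≥0∞ :=
  ENNReal.ofReal v * rearrangement f (v ^ κ)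

theorem measurable_scaledRearrangement (κ : ℝ) (f : Ω →ₘ[μ] 𝕜) :
    Measurable (scaledRearrangement κ f) :=
  ENNReal.measurable_ofReal.mul ((rearrangement_antitone f).measurable.comp (by fun_prop))

theorem scaledRearrangement_exp (κ : ℝ) (f : Ω →ₘ[μ] 𝕜) (x : ℝ) :
    scaledRearrangement κ f (Real.exp x) =
      ENNReal.ofReal (Real.exp x) * rearrangement f (Real.exp (κ * x)) := by
  rw [scaledRearrangement, ← Real.exp_mul, mul_comm x]

theorem wnorm_top_eq_iSup_of_antitone (α : ℝ) {F : ℝ → ℝ≥0∞} (hF : Antitone F) :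
    wnorm ∞ α (fun _ => 1) F (Ioi 0) =
      ⨆ x, ENNReal.ofReal (Real.exp (α * x)) * F (Real.exp x) := by
  have h := wnorm_image_exp ENNReal.top_ne_zero α (fun _ => 1) F MeasurableSet.univ
  simp only [image_univ, Real.range_exp, Measure.restrict_univ, mul_one, eLpNorm_exponent_top,
    eLpNormEssSup_eq_essSup_enorm, enorm_eq_self] at h
  rw [h]
  refine le_antisymm (essSup_le_of_ae_le _ (.of_forall fun x => le_iSup_of_le x le_rfl))
    (iSup_le fun x => mul_le_essSup_mul_of_antitone
      (ENNReal.continuous_ofReal.comp (by fun_prop : Continuous fun x => Real.exp (α * x)))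
      (hF.comp_monotone Real.exp_monotone) x)

theorem lorentzSpace_qnorm_eq_iSup {κ : ℝ} (hκ : 0 < κ) (f : Ω →ₘ[μ] 𝕜) :
    (lorentzSpace 𝕜 μ (ENNReal.ofReal κ) ∞).qnorm f =
      ⨆ x, scaledRearrangement κ f (Real.exp x) := by
  have hsurj : Function.Surjective fun x : ℝ => κ * x := mul_left_surjective₀ hκ.ne'
  dsimp only [lorentzSpace]
  rw [wnorm_top_eq_iSup_of_antitone _ (rearrangement_antitone f),
    ← hsurj.iSup_comp]
  simp only [scaledRearrangement_exp, ENNReal.toReal_inv, ENNReal.toReal_ofReal hκ.le,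
    inv_mul_cancel_left₀ hκ.ne']

theorem lorentzSpace_qnorm_le_eLpNorm {κ : ℝ} (hκ : 0 < κ) (f : Ω →ₘ[μ] 𝕜) :
    (lorentzSpace 𝕜 μ (ENNReal.ofReal κ) ∞).qnorm f ≤ eLpNorm f (ENNReal.ofReal κ) μ := by
  rw [lorentzSpace_qnorm_eq_iSup hκ]
  refine iSup_le fun x => ?_
  have h := rpow_mul_rearrangement_le_eLpNorm (by simpa using hκ) ENNReal.ofReal_ne_top f
    (Real.exp (κ * x)) (p := ENNReal.ofReal κ)
  rwa [ENNReal.toReal_ofReal hκ.le, ENNReal.ofReal_rpow_of_pos (Real.exp_pos _), ← Real.exp_mul,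
    mul_right_comm, mul_inv_cancel₀ hκ.ne', one_mul, ← scaledRearrangement_exp] at h

theorem kFunctional_lorentz_le_lebesgue {κ : ℝ} (hκ : 0 < κ) (v : ℝ) (f : Ω →ₘ[μ] 𝕜) :
    kFunctional (lorentzSpace 𝕜 μ (ENNReal.ofReal κ) ∞) (lebesgueSpace 𝕜 μ ∞) v f ≤
      kFunctional (lebesgueSpace 𝕜 μ (ENNReal.ofReal κ)) (lebesgueSpace 𝕜 μ ∞) v f :=
  kFunctional_mono_left (fun f hf => (lorentzSpace_qnorm_le_eLpNorm hκ f).trans_lt hf)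
    (lorentzSpace_qnorm_le_eLpNorm hκ) v f

theorem scaledRearrangement_le_kFunctional {κ : ℝ} (hκ : 0 < κ) (f : Ω →ₘ[μ] 𝕜) {v : ℝ}
    (hv : 0 < v) :
    scaledRearrangement κ f v ≤
      kFunctional (lorentzSpace 𝕜 μ (ENNReal.ofReal κ) ∞) (lebesgueSpace 𝕜 μ ∞) v f := by
  refine le_kFunctional ?_
  rintro f₀ - f₁ - rfl
  have h₀ : scaledRearrangement κ f₀ v ≤ (lorentzSpace 𝕜 μ (ENNReal.ofReal κ) ∞).qnorm f₀ := by
    rw [lorentzSpace_qnorm_eq_iSup hκ, ← Real.exp_log hv]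
    exact le_iSup (fun x => scaledRearrangement κ f₀ (Real.exp x)) _
  calc scaledRearrangement κ (f₀ + f₁) v
      ≤ ENNReal.ofReal v * (rearrangement f₀ (v ^ κ) + eLpNorm f₁ ∞ μ) :=
        mul_le_mul_right (rearrangement_add_le _ _ _) _
    _ = scaledRearrangement κ f₀ v + ENNReal.ofReal v * eLpNorm f₁ ∞ μ := mul_add _ _ _
    _ ≤ _ := add_le_add_left h₀ _

theorem rearrangement_rpow_mul_le {κ : ℝ} (hκ : 0 < κ) {δ : ℝ} (f : Ω →ₘ[μ] 𝕜) {x y : ℝ}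
    {M : ℝ≥0∞} (hM : ENNReal.ofReal (Real.exp δ) * scaledRearrangement κ f (Real.exp x) ≤ M) :
    rearrangement f (Real.exp (κ * x)) ^ κ * ENNReal.ofReal (Real.exp (κ * y)) ≤
      (ENNReal.ofReal (Real.exp (y - x - δ)) * M) ^ κ := by
  have hy : ENNReal.ofReal (Real.exp (κ * y)) = ENNReal.ofReal (Real.exp y) ^ κ := by
    rw [ENNReal.ofReal_rpow_of_pos (Real.exp_pos _), ← Real.exp_mul, mul_comm]
  have hexp : Real.exp y = Real.exp (y - x - δ) * (Real.exp δ * Real.exp x) := by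
    rw [← Real.exp_add, ← Real.exp_add]
    ring_nf
  rw [hy, ← ENNReal.mul_rpow_of_nonneg _ _ hκ.le]
  refine ENNReal.rpow_le_rpow ?_ hκ.le
  calc rearrangement f (Real.exp (κ * x)) * ENNReal.ofReal (Real.exp y)
      = ENNReal.ofReal (Real.exp (y - x - δ)) *
          (ENNReal.ofReal (Real.exp δ) * scaledRearrangement κ f (Real.exp x)) := by
        rw [scaledRearrangement_exp, hexp, ENNReal.ofReal_mul (Real.exp_nonneg _),
          ENNReal.ofReal_mul (Real.exp_nonneg _)]
        ring
    _ ≤ _ := mul_le_mul_right hM _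

theorem eLpNorm_restrict_rearrangement_lt_le {κ δ : ℝ} (hκ : 0 < κ) (hδ : 0 ≤ δ) (f : Ω →ₘ[μ] 𝕜)
    (x : ℝ) {M : ℝ≥0∞} (hM : ∀ j : ℕ, ENNReal.ofReal (Real.exp (δ * j)) *
      scaledRearrangement κ f (Real.exp (x - j)) ≤ M) :
    eLpNorm f (ENNReal.ofReal κ) (μ.restrict {y | rearrangement f (Real.exp (κ * x)) < ‖f y‖ₑ}) ≤
      (∑' j : ℕ, ENNReal.ofReal (Real.exp (-(δ * j))) ^ κ) ^ κ⁻¹ *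
        (ENNReal.ofReal (Real.exp 1) * M) := by
  set t : ℕ → ℝ := fun j => Real.exp (κ * (x - j))
  have ht : Tendsto t atTop (𝓝 0) :=
    Real.tendsto_exp_atBot.comp <| (tendsto_atBot_add_const_left _ x
      (tendsto_neg_atTop_atBot.comp tendsto_natCast_atTop_atTop)).const_mul_atBot hκ
  have ht₀ : t 0 = Real.exp (κ * x) := by simp [t]
  have hterm (j : ℕ) : rearrangement f (t (j + 1)) ^ κ * ENNReal.ofReal (t j) ≤
      ENNReal.ofReal (Real.exp (-(δ * j))) ^ κ * (ENNReal.ofReal (Real.exp 1) * M) ^ κ := by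
    refine (rearrangement_rpow_mul_le hκ f (hM (j + 1))).trans ?_
    rw [← ENNReal.mul_rpow_of_nonneg _ _ hκ.le, ← mul_assoc,
      ← ENNReal.ofReal_mul (Real.exp_nonneg _), ← Real.exp_add]
    gcongr
    push_cast
    linarith
  rw [← ht₀, eLpNorm_eq_lintegral_rpow_enorm_toReal (by simpa using hκ) ENNReal.ofReal_ne_top,
    ENNReal.toReal_ofReal hκ.le, one_div, ENNReal.rpow_inv_le_iff hκ,
    ENNReal.mul_rpow_of_nonneg _ _ hκ.le, ENNReal.rpow_inv_rpow hκ.ne', ← ENNReal.tsum_mul_right]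
  exact (lintegral_rearrangement_lt_le f ht hκ.le).trans (ENNReal.tsum_le_tsum hterm)

theorem exists_kFunctional_le_iSup_scaledRearrangement (𝕜 : Type*) [RCLike 𝕜] (μ : Measure Ω)
    {κ δ : ℝ} (hκ : 0 < κ) (hδ : 0 < δ) :
    ∃ C : ℝ≥0, ∀ (f : Ω →ₘ[μ] 𝕜) (x : ℝ),
      kFunctional (lebesgueSpace 𝕜 μ (ENNReal.ofReal κ)) (lebesgueSpace 𝕜 μ ∞) (Real.exp x) f ≤
        C * ⨆ j : ℕ, ENNReal.ofReal (Real.exp (δ * j)) *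
          scaledRearrangement κ f (Real.exp (x - j)) := by
  set S := (∑' j : ℕ, ENNReal.ofReal (Real.exp (-(δ * j))) ^ κ) ^ κ⁻¹
  have hS : S ≠ ∞ :=
    ENNReal.rpow_ne_top_of_nonneg (by positivity) (tsum_ofReal_exp_rpow_ne_top hδ hκ)
  refine ⟨(S * ENNReal.ofReal (Real.exp 1)).toNNReal + 1, fun f x => ?_⟩
  rw [ENNReal.coe_add, ENNReal.coe_toNNReal (ENNReal.mul_ne_top hS ENNReal.ofReal_ne_top),
    ENNReal.coe_one, add_mul, one_mul, mul_assoc]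
  set M := ⨆ j : ℕ, ENNReal.ofReal (Real.exp (δ * j)) * scaledRearrangement κ f (Real.exp (x - j))
  have hM (j : ℕ) : ENNReal.ofReal (Real.exp (δ * j)) *
      scaledRearrangement κ f (Real.exp (x - j)) ≤ M := le_iSup_of_le j le_rfl
  have hlow : ENNReal.ofReal (Real.exp x) * rearrangement f (Real.exp (κ * x)) ≤ M := by
    simpa [scaledRearrangement_exp] using hM 0
  exact (kFunctional_lebesgue_le_truncation _ f (Real.exp_pos x) _).trans
    (add_le_add (eLpNorm_restrict_rearrangement_lt_le hκ hδ.le f x hM) hlow)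

end KFunctionalEstimates

section Spaces

namespace QSpace

variable {V : Type*} {X Y Z : QSpace V}

/-- The elements of `X` are exactly the elements of the ambient space with finite quasi-norm. -/
def HasFiniteCarrier (X : QSpace V) : Prop :=
  ∀ f, f ∈ X.carrier ↔ X.qnorm f < ∞

theorem Embeds.of_qnorm_le (hX : X.HasFiniteCarrier) (hY : Y.HasFiniteCarrier) (C : ℝ≥0)
    (h : ∀ f, Y.qnorm f ≤ C * X.qnorm f) : X.Embeds Y :=
  ⟨fun f hf => (hY f).2 ((h f).trans_lt (ENNReal.mul_lt_top ENNReal.coe_lt_top ((hX f).1 hf))),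
    C, fun f _ => h f⟩

theorem Embeds.trans (hXY : X.Embeds Y) (hYZ : Y.Embeds Z) : X.Embeds Z := by
  obtain ⟨hXY, C, hC⟩ := hXY
  obtain ⟨hYZ, D, hD⟩ := hYZ
  refine ⟨hXY.trans hYZ, D * C, fun f hf => (hD f (hXY hf)).trans ?_⟩
  rw [ENNReal.coe_mul, mul_assoc]
  exact mul_le_mul_right (hC f hf) _

end QSpace

variable {s r q : ℝ≥0∞} {c b a : ℝ → ℝ}

theorem llInterpolation_hasFiniteCarrier {V : Type*} [Add V] (A₀ A₁ : QSpace V) (θ : ℝ)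
    (hs : s ≠ 0) (hr : r ≠ 0) (hq : q ≠ 0) (hc : ∀ t, 0 < t → 0 < c t)
    (hb : ∀ t, 0 < t → 0 < b t) (ha : ∀ t, 0 < t → 0 < a t) :
    (llInterpolation A₀ A₁ θ s c r b q a).HasFiniteCarrier := by
  refine fun f => ⟨fun h => h.2, fun h => ⟨?_, h⟩⟩
  by_contra hf
  simp only [llInterpolation, kFunctional_eq_top hf] at h
  exact h.ne (llNorm_top hs hr hq hc hb ha)

variable {Ω : Type*} [MeasurableSpace Ω] {𝕜 : Type*} [RCLike 𝕜] {μ : Measure Ω} {θ κ : ℝ} {p : ℝ≥0∞}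

theorem llSpace_hasFiniteCarrier : (llSpace 𝕜 μ p s c r b q a).HasFiniteCarrier :=
  fun _ => Iff.rfl

theorem exists_llSpace_qnorm_eq (𝕜 : Type*) [RCLike 𝕜] (μ : Measure Ω) (hκ : 0 < κ)
    (hp : (p⁻¹).toReal = (1 - θ) / κ) (hs : s ≠ 0) (hr : r ≠ 0) (hq : q ≠ 0) :
    ∃ k : ℝ≥0, k ≠ 0 ∧ ∀ f : Ω →ₘ[μ] 𝕜,
      llNorm (-θ) s c r b q a (scaledRearrangement κ f) =
        k * (llSpace 𝕜 μ p s (dil κ c) r (dil κ b) q (dil κ a)).qnorm f := by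
  have hκ' : κ⁻¹.toNNReal ≠ 0 := by simpa using hκ
  refine ⟨κ⁻¹.toNNReal ^ ((q⁻¹).toReal + (r⁻¹).toReal + (s⁻¹).toReal),
    (NNReal.rpow_pos hκ'.bot_lt).ne', fun f => ?_⟩
  refine (llNorm_mul_ofReal (F := fun v => rearrangement f (v ^ κ))).trans ?_
  rw [llNorm_comp_rpow hs hr hq hκ, neg_add_eq_sub, ← hp, ENNReal.coe_rpow_of_ne_zero hκ']
  rfl

theorem exists_wnorm_kFunctional_le (𝕜 : Type*) [RCLike 𝕜] (μ : Measure Ω) (hκ : 0 < κ)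
    (hq : q ≠ 0) {ε : ℝ} (hε : ε < θ) (ham : AEMeasurable a (volume.restrict (Ioi 0)))
    (ha : AlmostDecreasing fun t => t ^ (-ε) * a t) :
    ∃ C : ℝ≥0, ∀ (f : Ω →ₘ[μ] 𝕜) (u : ℝ), 0 < u →
      wnorm q (-θ) a (fun v => kFunctional (lebesgueSpace 𝕜 μ (ENNReal.ofReal κ))
          (lebesgueSpace 𝕜 μ ∞) v f) (Ioo 0 u) ≤
        C * wnorm q (-θ) a (scaledRearrangement κ f) (Ioo 0 u) := by
  obtain ⟨δ, hδ, hδθ⟩ := exists_between (sub_pos.2 hε)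
  obtain ⟨D, hD⟩ := exists_kFunctional_le_iSup_scaledRearrangement 𝕜 μ hκ hδ
  obtain ⟨C, hC⟩ := exists_wnorm_le_of_le_iSup hq (lt_sub_iff_add_lt'.1 hδθ) ham ha
  refine ⟨C * D, fun f u hu => ?_⟩
  rw [ENNReal.coe_mul, mul_assoc, ← wnorm_const_mul ENNReal.coe_ne_top]
  refine hC _ _ ((measurable_scaledRearrangement κ f).const_mul _) (fun x => ?_) u hu
  simpa only [ENNReal.mul_iSup, mul_left_comm] using hD f x

theorem llInterpolation_lebesgue_embeds_lorentz (hκ : 0 < κ) (hs : s ≠ 0) (hr : r ≠ 0)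
    (hq : q ≠ 0) (hc : ∀ t, 0 < t → 0 < c t) (hb : ∀ t, 0 < t → 0 < b t)
    (ha : ∀ t, 0 < t → 0 < a t) :
    (llInterpolation (lebesgueSpace 𝕜 μ (ENNReal.ofReal κ)) (lebesgueSpace 𝕜 μ ∞)
      θ s c r b q a).Embeds
    (llInterpolation (lorentzSpace 𝕜 μ (ENNReal.ofReal κ) ∞) (lebesgueSpace 𝕜 μ ∞)
      θ s c r b q a) := by
  refine .of_qnorm_le (llInterpolation_hasFiniteCarrier _ _ θ hs hr hq hc hb ha)
    (llInterpolation_hasFiniteCarrier _ _ θ hs hr hq hc hb ha) 1 fun f => ?_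
  rw [ENNReal.coe_one, one_mul]
  exact llNorm_mono fun v _ => kFunctional_lorentz_le_lebesgue hκ v f

theorem llInterpolation_lorentz_embeds_llSpace (hκ : 0 < κ) (hp : (p⁻¹).toReal = (1 - θ) / κ)
    (hs : s ≠ 0) (hr : r ≠ 0) (hq : q ≠ 0) (hc : ∀ t, 0 < t → 0 < c t)
    (hb : ∀ t, 0 < t → 0 < b t) (ha : ∀ t, 0 < t → 0 < a t) :
    (llInterpolation (lorentzSpace 𝕜 μ (ENNReal.ofReal κ) ∞) (lebesgueSpace 𝕜 μ ∞)
      θ s c r b q a).Embeds (llSpace 𝕜 μ p s (dil κ c) r (dil κ b) q (dil κ a)) := by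
  obtain ⟨k, hk, hnorm⟩ := exists_llSpace_qnorm_eq 𝕜 μ hκ hp hs hr hq
  refine .of_qnorm_le (llInterpolation_hasFiniteCarrier _ _ θ hs hr hq hc hb ha)
    llSpace_hasFiniteCarrier k⁻¹ fun f => ?_
  rw [ENNReal.coe_inv hk, mul_comm, ← div_eq_mul_inv, ENNReal.le_div_iff_mul_le
    (.inl (ENNReal.coe_ne_zero.2 hk)) (.inl ENNReal.coe_ne_top), mul_comm, ← hnorm]
  exact llNorm_mono fun v hv => scaledRearrangement_le_kFunctional hκ f hv

theorem llSpace_embeds_llInterpolation_lebesgue (hκ : 0 < κ)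
    (hp : (p⁻¹).toReal = (1 - θ) / κ) (hs : s ≠ 0) (hr : r ≠ 0) (hq : q ≠ 0)
    (hc : ∀ t, 0 < t → 0 < c t) (hb : ∀ t, 0 < t → 0 < b t) (ha : ∀ t, 0 < t → 0 < a t)
    {ε : ℝ} (hε : ε < θ) (ham : AEMeasurable a (volume.restrict (Ioi 0)))
    (ha_anti : AlmostDecreasing fun t => t ^ (-ε) * a t) :
    (llSpace 𝕜 μ p s (dil κ c) r (dil κ b) q (dil κ a)).Embeds
      (llInterpolation (lebesgueSpace 𝕜 μ (ENNReal.ofReal κ)) (lebesgueSpace 𝕜 μ ∞)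
        θ s c r b q a) := by
  obtain ⟨k, -, hnorm⟩ := exists_llSpace_qnorm_eq 𝕜 μ hκ hp hs hr hq
  obtain ⟨C, hC⟩ := exists_wnorm_kFunctional_le 𝕜 μ hκ hq hε ham ha_anti
  refine .of_qnorm_le llSpace_hasFiniteCarrier
    (llInterpolation_hasFiniteCarrier _ _ θ hs hr hq hc hb ha) (C * k) fun f => ?_
  rw [ENNReal.coe_mul, mul_assoc, ← hnorm]
  exact llNorm_le_mul_of_wnorm_le C (hC f)

end Spaces

end LorentzKaramata

open LorentzKaramata in
theorem theorem5p3_general {Ω : Type*} [MeasurableSpace Ω] (𝕜 : Type*) [RCLike 𝕜] (μ : Measure Ω)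
    (θ κ ε : ℝ) (hθ₁ : θ ≤ 1) (hκ : 0 < κ) (hε : ε < θ)
    (p : ℝ≥0∞) (hp : p = ENNReal.ofReal κ / ENNReal.ofReal (1 - θ))
    (q r s : ℝ≥0∞) (hq : 0 < q) (hr : 0 < r) (hs : 0 < s) (a b c : ℝ → ℝ)
    (ha : ∀ t, 0 < t → 0 < a t) (ham : AEMeasurable a (volume.restrict (Ioi 0)))
    (ha_anti : AlmostDecreasing fun t => t ^ (-ε) * a t)
    (hb : ∀ t, 0 < t → 0 < b t) (hc : ∀ t, 0 < t → 0 < c t) :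
    (llInterpolation (lebesgueSpace 𝕜 μ (ENNReal.ofReal κ)) (lebesgueSpace 𝕜 μ ∞)
        θ s c r b q a).Identical
      (llInterpolation (lorentzSpace 𝕜 μ (ENNReal.ofReal κ) ∞) (lebesgueSpace 𝕜 μ ∞)
        θ s c r b q a) ∧
    (llInterpolation (lorentzSpace 𝕜 μ (ENNReal.ofReal κ) ∞) (lebesgueSpace 𝕜 μ ∞)
        θ s c r b q a).Identical
      (llSpace 𝕜 μ p s (dil κ c) r (dil κ b) q (dil κ a)) := by
  have hp_inv : (p⁻¹).toReal = (1 - θ) / κ := by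
    rw [hp, ENNReal.inv_div (.inl ENNReal.ofReal_ne_top) (.inr (by simpa using hκ)),
      ENNReal.toReal_div, ENNReal.toReal_ofReal (sub_nonneg.2 hθ₁), ENNReal.toReal_ofReal hκ.le]
  have h_lebesgue_lorentz := llInterpolation_lebesgue_embeds_lorentz (𝕜 := 𝕜) (μ := μ) (θ := θ)
    hκ hs.ne' hr.ne' hq.ne' hc hb ha
  have h_lorentz_ll := llInterpolation_lorentz_embeds_llSpace (𝕜 := 𝕜) (μ := μ)
    hκ hp_inv hs.ne' hr.ne' hq.ne' hc hb ha
  have h_ll_lebesgue := llSpace_embeds_llInterpolation_lebesgue (𝕜 := 𝕜) (μ := μ)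
    hκ hp_inv hs.ne' hr.ne' hq.ne' hc hb ha hε ham ha_anti
  exact ⟨⟨h_lebesgue_lorentz, h_lorentz_ll.trans h_ll_lebesgue⟩,
    h_lorentz_ll, h_ll_lebesgue.trans h_lebesgue_lorentz⟩

theorem theorem5p3 {Ω : Type*} [MeasurableSpace Ω] (𝕜 : Type*) [RCLike 𝕜]
    (μ : Measure Ω) [SigmaFinite μ] (hμ : LorentzKaramata.NonAtomic μ)
    (θ κ : ℝ) (hθ₀ : 0 < θ) (hθ₁ : θ ≤ 1) (hκ : 0 < κ)
    (p : ℝ≥0∞) (hp : p = ENNReal.ofReal κ / ENNReal.ofReal (1 - θ))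
    (q r s : ℝ≥0∞) (hq : 0 < q) (hr : 0 < r) (hs : 0 < s)
    (a b c : ℝ → ℝ) (ha : LorentzKaramata.SlowlyVarying a)
    (hb : LorentzKaramata.SlowlyVarying b) (hc : LorentzKaramata.SlowlyVarying c) :
    (LorentzKaramata.llInterpolation
        (LorentzKaramata.lebesgueSpace 𝕜 μ (ENNReal.ofReal κ))
        (LorentzKaramata.lebesgueSpace 𝕜 μ ∞) θ s c r b q a).Identical
      (LorentzKaramata.llInterpolation
        (LorentzKaramata.lorentzSpace 𝕜 μ (ENNReal.ofReal κ) ∞)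
        (LorentzKaramata.lebesgueSpace 𝕜 μ ∞) θ s c r b q a) ∧
    (LorentzKaramata.llInterpolation
        (LorentzKaramata.lorentzSpace 𝕜 μ (ENNReal.ofReal κ) ∞)
        (LorentzKaramata.lebesgueSpace 𝕜 μ ∞) θ s c r b q a).Identical
      (LorentzKaramata.llSpace 𝕜 μ p s (LorentzKaramata.dil κ c) r (LorentzKaramata.dil κ b)
        q (LorentzKaramata.dil κ a)) :=
  theorem5p3_general 𝕜 μ θ κ (θ / 2) hθ₁ hκ (half_lt_self hθ₀) p hp q r s hq hr hs a b c ha.pos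
    ha.measurable (ha.almostDecreasing (half_pos hθ₀)) hb.pos hc.pos
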